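/- Let $a>0$ and $\gamma>1/2$. Let $D^{1,2}(\mathbb R^3)=\{u\in L^6(\mathbb R^3):|\nabla u|\in L^2(\mathbb R^3)\}$ ($\nabla u$ the weak gradient), let $\mathcal K(x)=\frac{1-e^{-|x|/a}}{|x|}$ and, for measurable $u:\mathbb R^3\to\mathbb R$, $$V(u^2,u^2)=\int_{\mathbb R^3}\int_{\mathbb R^3}\mathcal K(x-y)\,u^2(x)\,u^2(y)\,dx\,dy\in[0,+\infty].$$ Let $$\mathcal E=\{u\in D^{1,2}(\mathbb R^3): V(u^2,u^2)<+\infty\},\qquad \|u\|_{\mathcal E}=\Big(\|\nabla u\|_2^2+V(u^2,u^2)^{1/2}\Big)^{1/2}.$$ With the weight $Z(x)=(1+|x|)^{-\gamma}$ let $L^2_Z(\mathbb R^3)$ be the space of measurable $u:\mathbb R^3\to\mathbb R$ such that $\|u\|_{L^2_Z}^2=\int_{\mathbb R^3}Z u^2\,dx<+\infty$, and let $H_Z(\mathbb R^3)=D^{1,2}(\mathbb R^3)\cap L^2_Z(\mathbb R^3)$ with the norm $\|u\|_{H_Z}=\big(\int_{\mathbb R^3}(|\nabla u|^2+Zu^2)\,dx\big)^{1/2}$.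 Then $\mathcal E$ is continuously embedded into $H_Z(\mathbb R^3)$: $\mathcal E\subset H_Z(\mathbb R^3)$, and there is a constant $C=C(a,\gamma)$ with $\|u\|_{H_Z}\le C\|u\|_{\mathcal E}$ for all $u\in\mathcal E$. Moreover, the embedding $\mathcal E\hookrightarrow L^2_Z(\mathbb R^3)$ is compact: it is continuous, and every sequence that is bounded in $\mathcal E$ has a subsequence that converges in $L^2_Z(\mathbb R^3)$. -/

import Mathlib

open MeasureTheory Filter Topology
open scoped ENNReal NNReal ContDiff

namespace BoppPodolsky

/-- Three-dimensional Euclidean space. -/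
abbrev R3 : Type := EuclideanSpace ℝ (Fin 3)

/-- `g` is the weak (distributional) gradient of `u`: both are locally integrable and
`∫ u ∂ᵢφ = - ∫ gᵢ φ` for all test functions `φ ∈ C_c^∞(ℝ³)` and `i = 1, 2, 3`.
Such a `g` is unique up to a null set. -/
structure HasWeakGradient (u : R3 → ℝ) (g : R3 → R3) : Prop where
  locallyIntegrable : LocallyIntegrable u volume
  locallyIntegrable_grad : LocallyIntegrable g volume
  integral_eq : ∀ φ : R3 → ℝ, ContDiff ℝ (∞ : ℕ∞ω) φ → HasCompactSupport φ → ∀ i : Fin 3,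
    ∫ x, u x * fderiv ℝ φ x (EuclideanSpace.single i 1) = - ∫ x, g x i * φ x

open Classical in
/-- The weak gradient `∇u` (a representative of it); `0` if `u` has none. -/
noncomputable def weakGradient (u : R3 → ℝ) : R3 → R3 :=
  if h : ∃ g, HasWeakGradient u g then h.choose else 0

theorem hasWeakGradient_weakGradient {u : R3 → ℝ} (h : ∃ g, HasWeakGradient u g) :
    HasWeakGradient u (weakGradient u) := by
  rw [weakGradient, dif_pos h]
  exact h.choose_spec

/-- `u ∈ D^{1,2}(ℝ³)`: `u ∈ L⁶(ℝ³)` with weak gradient in `L²(ℝ³)`. -/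
def MemD12 (u : R3 → ℝ) : Prop :=
  MemLp u 6 volume ∧ (∃ g, HasWeakGradient u g) ∧ MemLp (weakGradient u) 2 volume

/-- `‖∇u‖₂`, the norm of `D^{1,2}(ℝ³)`. -/
noncomputable def normD12 (u : R3 → ℝ) : ℝ≥0∞ := eLpNorm (weakGradient u) 2 volume

/-- The Bopp-Podolsky potential `𝒦(x) = (1 - e^{-|x|/a}) / |x|`
(its value at the single point `0` plays no role). -/
noncomputable def kernel (a : ℝ) (x : R3) : ℝ := (1 - Real.exp (-‖x‖ / a)) / ‖x‖

/-- The Bopp-Podolsky energy `V(f,g) = ∫∫ 𝒦(x-y) f(x) g(y) dx dy` of nonnegative `f`, `g`,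
for `a > 0` (so that `𝒦 ≥ 0`). -/
noncomputable def energy (a : ℝ) (f g : R3 → ℝ≥0∞) : ℝ≥0∞ :=
  ∫⁻ x, ∫⁻ y, ENNReal.ofReal (kernel a (x - y)) * f x * g y

/-- `V(u²,u²)`. -/
noncomputable def energySq (a : ℝ) (u : R3 → ℝ) : ℝ≥0∞ :=
  energy a (fun x => ENNReal.ofReal (u x ^ 2)) (fun x => ENNReal.ofReal (u x ^ 2))

/-- `u ∈ ℰ`: `u ∈ D^{1,2}(ℝ³)` and `V(u²,u²) < ∞`. -/
def MemE (a : ℝ) (u : R3 → ℝ) : Prop := MemD12 u ∧ energySq a u < ⊤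

/-- `‖u‖_ℰ = (‖∇u‖₂² + V(u²,u²)^{1/2})^{1/2}`. -/
noncomputable def normE (a : ℝ) (u : R3 → ℝ) : ℝ≥0∞ :=
  (normD12 u ^ 2 + energySq a u ^ (1 / 2 : ℝ)) ^ (1 / 2 : ℝ)

/-- The weight `Z(x) = (1 + |x|)^{-γ}`. -/
noncomputable def weightZ (γ : ℝ) (x : R3) : ℝ := 1 / (1 + ‖x‖) ^ γ

/-- The measure `Z(x) dx`. -/
noncomputable def measureZ (γ : ℝ) : Measure R3 :=
  volume.withDensity (fun x => ENNReal.ofReal (weightZ γ x))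

/-- `u ∈ L²_Z(ℝ³)`: `∫ Z u² dx < ∞` (and `u` is measurable). -/
def MemL2Z (γ : ℝ) (u : R3 → ℝ) : Prop := MemLp u 2 (measureZ γ)

/-- `‖u‖_{L²_Z} = (∫ Z u² dx)^{1/2}`. -/
noncomputable def normL2Z (γ : ℝ) (u : R3 → ℝ) : ℝ≥0∞ := eLpNorm u 2 (measureZ γ)

/-- `u ∈ H_Z(ℝ³) = D^{1,2}(ℝ³) ∩ L²_Z(ℝ³)`. -/
def MemHZ (γ : ℝ) (u : R3 → ℝ) : Prop := MemD12 u ∧ MemL2Z γ u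

/-- `‖u‖_{H_Z} = (∫ |∇u|² + Z u² dx)^{1/2}`. -/
noncomputable def normHZ (γ : ℝ) (u : R3 → ℝ) : ℝ≥0∞ :=
  (normD12 u ^ 2 + normL2Z γ u ^ 2) ^ (1 / 2 : ℝ)

/-- Continuous embedding `X ↪ Y` of two normed function spaces on `ℝ³`, each given by its
membership predicate and its norm: `X ⊆ Y`, and the (linear) inclusion is bounded,
`‖u‖_Y ≤ C ‖u‖_X`. -/
def ContinuouslyEmbedded (memX : (R3 → ℝ) → Prop) (normX : (R3 → ℝ) → ℝ≥0∞)
    (memY : (R3 → ℝ) → Prop) (normY : (R3 → ℝ) → ℝ≥0∞) : Prop :=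
  (∀ u, memX u → memY u) ∧ ∃ C : ℝ≥0, ∀ u, memX u → normY u ≤ C * normX u

/-- Compact embedding: a continuous embedding such that each sequence that is bounded in `X`
has a subsequence converging in the norm of `Y` to an element of `Y`. -/
def CompactlyEmbedded (memX : (R3 → ℝ) → Prop) (normX : (R3 → ℝ) → ℝ≥0∞)
    (memY : (R3 → ℝ) → Prop) (normY : (R3 → ℝ) → ℝ≥0∞) : Prop :=
  ContinuouslyEmbedded memX normX memY normY ∧
    ∀ u : ℕ → R3 → ℝ, (∀ n, memX (u n)) → (∃ R : ℝ≥0, ∀ n, normX (u n) ≤ R) →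
      ∃ (v : R3 → ℝ) (k : ℕ → ℕ), memY v ∧ StrictMono k ∧
        Tendsto (fun n => normY (u (k n) - v)) atTop (𝓝 0)

end BoppPodolsky

namespace BoppPodolsky

/-! Since 1 + t ≤ e^t, the kernel satisfies 𝒦(x) ≥ 1/(a + |x|) off the origin. Two points of the
ball B_R are less than 2R apart, so ∫_{B_R} u² ≤ (a + 2R)^{1/2} V(u²,u²)^{1/2}
(`setLIntegral_ball_le`). At fixed energy the mass of B_R thus grows at most like R^{1/2}, and a
dyadic sum against a weight decaying like |x|^{-γ} converges because γ > 1/2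
(`exists_normL2Z_sq_le`). This is the continuous embedding.

For compactness, a bounded sequence has a weakly convergent subsequence in the Hilbert space L²_Z,
and three errors make the convergence strong. Replacing u by its means over balls of radius ε costs
at most ε‖∇u‖₂ in L² (`HasWeakGradient.lintegral_sub_ballAverage_le`). These means are inner
products in L²_Z with fixed kernels, so weak convergence makes them converge pointwise and, by
domination, in L² of each ball (`tendsto_lintegral_ballAverage`). The tails are uniformly small
because the sequence is also bounded in L²_Z for a slower weight, with exponent β in (1/2, γ)
(`setLIntegral_compl_ball_le`). -/

/-! ### Energy, mass in balls and the weighted norm -/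

theorem inv_le_kernel {a : ℝ} (ha : 0 < a) {x : R3} (hx : x ≠ 0) :
    1 / (a + ‖x‖) ≤ kernel a x := by
  have hr : 0 < ‖x‖ := norm_pos_iff.2 hx
  -- This is e^{-t} ≤ 1/(1 + t) at t = |x|/a.
  have h1 : Real.exp (-‖x‖ / a) ≤ a / (a + ‖x‖) := by
    rw [neg_div, Real.exp_neg, inv_le_comm₀ (Real.exp_pos _) (by positivity)]
    have := Real.add_one_le_exp (‖x‖ / a)
    calc (a / (a + ‖x‖))⁻¹ = ‖x‖ / a + 1 := by field_simp; ring
      _ ≤ _ := this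
  rw [kernel, le_div_iff₀ hr]
  calc 1 / (a + ‖x‖) * ‖x‖ = 1 - a / (a + ‖x‖) := by field_simp; ring
    _ ≤ _ := by linarith

/-- The energy controls the mass in a ball. -/
theorem sq_setLIntegral_ball_le_energySq {a : ℝ} (ha : 0 < a) {u : R3 → ℝ}
    {R : ℝ} :
    ENNReal.ofReal (1 / (a + 2 * R)) *
      (∫⁻ x in Metric.ball 0 R, ENNReal.ofReal (u x ^ 2)) ^ 2 ≤ energySq a u := by
  set f : R3 → ℝ≥0∞ := fun x => ENNReal.ofReal (u x ^ 2)
  set c := ENNReal.ofReal (1 / (a + 2 * R))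
  set B := Metric.ball (0 : R3) R
  have hf : ∀ x, f x ≠ ⊤ := fun x => ENNReal.ofReal_ne_top
  have hc : c ≠ ⊤ := ENNReal.ofReal_ne_top
  calc c * (∫⁻ x in B, f x) ^ 2
      ≤ ∫⁻ x in B, ∫⁻ y in B, c * f x * f y := by
        rw [sq, ← mul_assoc]
        simp_rw [lintegral_const_mul' _ _ (ENNReal.mul_ne_top hc (hf _))]
        -- Only this inequality is available: `u` need not be measurable and its mass in the ball
        -- may be infinite.
        refine le_of_eq_of_le ?_ (lintegral_mul_const_le _ _)
        rw [lintegral_const_mul' _ _ hc]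
    _ ≤ ∫⁻ x in B, ∫⁻ y in B, ENNReal.ofReal (kernel a (x - y)) * f x * f y := by
        refine setLIntegral_mono' measurableSet_ball fun x hx => ?_
        refine lintegral_mono_ae ?_
        -- The diagonal y = x must be removed: there `kernel` takes the default value 0 and the
        -- lower bound fails.
        filter_upwards [ae_restrict_mem measurableSet_ball,
          ae_restrict_of_ae (Measure.ae_ne volume x)] with y hy hne
        gcongr
        refine ENNReal.ofReal_le_ofReal ?_
        refine (one_div_le_one_div_of_le ?_ ?_).trans (inv_le_kernel ha (sub_ne_zero.2 hne.symm))
        · positivity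
        · have h1 := norm_sub_le x y
          rw [mem_ball_zero_iff] at hx hy
          linarith
    _ ≤ ∫⁻ x in B, ∫⁻ y, ENNReal.ofReal (kernel a (x - y)) * f x * f y :=
        lintegral_mono fun x => setLIntegral_le_lintegral _ _
    _ ≤ _ := setLIntegral_le_lintegral _ _

theorem setLIntegral_ball_le {a : ℝ} (ha : 0 < a) {u : R3 → ℝ} {R : ℝ} (hR : 0 < R) :
    ∫⁻ x in Metric.ball 0 R, ENNReal.ofReal (u x ^ 2)
      ≤ ENNReal.ofReal ((a + 2 * R) ^ (1 / 2 : ℝ)) * energySq a u ^ (1 / 2 : ℝ) := by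
  have h := sq_setLIntegral_ball_le_energySq ha (u := u) (R := R)
  set m := ∫⁻ x in Metric.ball 0 R, ENNReal.ofReal (u x ^ 2)
  have hp : 0 < a + 2 * R := by positivity
  have h2 : m ^ 2 ≤ ENNReal.ofReal (a + 2 * R) * energySq a u := by
    calc m ^ 2 = ENNReal.ofReal (a + 2 * R) * (ENNReal.ofReal (1 / (a + 2 * R)) * m ^ 2) := by
          rw [← mul_assoc, ← ENNReal.ofReal_mul hp.le, mul_one_div_cancel hp.ne']; simp
      _ ≤ _ := by gcongr
  calc m = (m ^ 2) ^ (1 / 2 : ℝ) := by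
        rw [← ENNReal.rpow_natCast, ← ENNReal.rpow_mul]; norm_num
    _ ≤ _ := by
        rw [← ENNReal.ofReal_rpow_of_nonneg hp.le (by norm_num),
          ← ENNReal.mul_rpow_of_nonneg _ _ (by norm_num)]
        gcongr

theorem measurable_weightZ (γ : ℝ) : Measurable (weightZ γ) := by
  unfold weightZ
  fun_prop

theorem weightZ_pos (γ : ℝ) (x : R3) : 0 < weightZ γ x := by
  unfold weightZ
  positivity

/-- Dyadic majorant of the weight. -/
theorem ofReal_weightZ_le_tsum {γ : ℝ} (hγ : 0 ≤ γ) (x : R3) :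
    ENNReal.ofReal (weightZ γ x) ≤
      ∑' k : ℕ, (Metric.ball (0 : R3) (2 ^ (k + 1))).indicator
        (fun _ => ENNReal.ofReal ((2 ^ (-γ)) ^ k)) x := by
  -- With 2^k ≤ 1 + |x| < 2^(k+1), the single term of index k already dominates: the first
  -- inequality bounds the weight, the second puts x in the ball.
  obtain ⟨k, hk1, hk2⟩ := exists_nat_pow_near (x := 1 + ‖x‖) (y := (2 : ℝ))
    (by linarith [norm_nonneg x]) one_lt_two
  refine le_trans ?_ (ENNReal.le_tsum k)
  rw [Set.indicator_of_mem (by rw [mem_ball_zero_iff]; linarith)]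
  refine ENNReal.ofReal_le_ofReal ?_
  rw [weightZ, ← Real.rpow_natCast, ← Real.rpow_mul zero_le_two, mul_comm,
    Real.rpow_mul zero_le_two, Real.rpow_natCast, Real.rpow_neg (by positivity), one_div]
  gcongr

theorem eLpNorm_two_sq {α : Type*} [MeasurableSpace α] {μ : Measure α} (f : α → ℝ) :
    eLpNorm f 2 μ ^ 2 = ∫⁻ x, ‖f x‖ₑ ^ 2 ∂μ := by
  rw [eLpNorm_eq_lintegral_rpow_enorm_toReal (by norm_num) (by norm_num), ← ENNReal.rpow_natCast,
    ← ENNReal.rpow_mul]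
  norm_num

theorem normL2Z_sq (γ : ℝ) (u : R3 → ℝ) :
    normL2Z γ u ^ 2 = ∫⁻ x, ‖u x‖ₑ ^ 2 ∂measureZ γ :=
  eLpNorm_two_sq u

theorem lintegral_measureZ {γ : ℝ} (f : R3 → ℝ≥0∞) :
    ∫⁻ x, f x ∂measureZ γ = ∫⁻ x, ENNReal.ofReal (weightZ γ x) * f x := by
  rw [measureZ, lintegral_withDensity_eq_lintegral_mul_non_measurable _
    (measurable_weightZ γ).ennreal_ofReal (ae_of_all _ fun x => ENNReal.ofReal_lt_top)]
  rfl

theorem enorm_sq_eq_ofReal (r : ℝ) : ‖r‖ₑ ^ 2 = ENNReal.ofReal (r ^ 2) := by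
  rw [← enorm_pow, Real.enorm_eq_ofReal (sq_nonneg r)]

/-- The energy controls the weighted `L²` norm. -/
theorem exists_normL2Z_sq_le {a : ℝ} (ha : 0 < a) {γ : ℝ} (hγ : 1 / 2 < γ) :
    ∃ C : ℝ≥0, ∀ u : R3 → ℝ, AEStronglyMeasurable u volume →
      normL2Z γ u ^ 2 ≤ C * energySq a u ^ (1 / 2 : ℝ) := by
  -- The ratio combines the decay 2^{-γ} of the weight with the growth 2^{1/2} of the mass bound
  -- from one dyadic ball to the next.
  set q : ℝ := 2 ^ (1 / 2 - γ)
  have hq0 : 0 ≤ q := by positivity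
  have hq1 : q < 1 := Real.rpow_lt_one_of_one_lt_of_neg one_lt_two (by linarith)
  -- Chosen so that a + 2·2^(k+1) = a + 4·2^k ≤ (a + 4)·2^k.
  set A : ℝ := (a + 4) ^ (1 / 2 : ℝ)
  have hsum : Summable fun k : ℕ => A * q ^ k := (summable_geometric_of_lt_one hq0 hq1).mul_left _
  have hterm : ∀ k : ℕ, ((2 : ℝ) ^ (-γ)) ^ k * (a + 2 * 2 ^ (k + 1)) ^ (1 / 2 : ℝ) ≤ A * q ^ k := by
    intro k
    have h2 : (1 : ℝ) ≤ 2 ^ k := one_le_pow₀ one_le_two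
    have h1 : (a + 2 * 2 ^ (k + 1)) ^ (1 / 2 : ℝ) ≤ A * (2 ^ k) ^ (1 / 2 : ℝ) := by
      rw [← Real.mul_rpow (by positivity) (by positivity)]
      refine Real.rpow_le_rpow (by positivity) ?_ (by norm_num)
      rw [pow_succ]
      nlinarith
    have h3 : q ^ k = ((2 : ℝ) ^ (-γ)) ^ k * (2 ^ k) ^ (1 / 2 : ℝ) := by
      rw [← Real.rpow_natCast, ← Real.rpow_natCast, ← Real.rpow_natCast, ← Real.rpow_mul zero_le_two,
        ← Real.rpow_mul zero_le_two, ← Real.rpow_mul zero_le_two, ← Real.rpow_add two_pos]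
      congr 1; ring
    calc _ ≤ ((2 : ℝ) ^ (-γ)) ^ k * (A * (2 ^ k) ^ (1 / 2 : ℝ)) := by gcongr
      _ = _ := by rw [h3]; ring
  refine ⟨Real.toNNReal (∑' k, A * q ^ k), fun u hu => ?_⟩
  have hfm : AEMeasurable (fun x => ‖u x‖ₑ ^ 2) volume := hu.enorm.pow_const 2
  rw [normL2Z_sq, lintegral_measureZ]
  calc ∫⁻ x, ENNReal.ofReal (weightZ γ x) * ‖u x‖ₑ ^ 2
      ≤ ∫⁻ x, ∑' k : ℕ, (Metric.ball (0 : R3) (2 ^ (k + 1))).indicator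
        (fun x => ENNReal.ofReal ((2 ^ (-γ)) ^ k) * ‖u x‖ₑ ^ 2) x := by
        refine lintegral_mono fun x => ?_
        refine (mul_le_mul_left (ofReal_weightZ_le_tsum (by linarith) x) _).trans_eq ?_
        rw [← ENNReal.tsum_mul_right]
        refine tsum_congr fun k => ?_
        by_cases hx : x ∈ Metric.ball (0 : R3) (2 ^ (k + 1)) <;> simp [hx]
    _ = ∑' k : ℕ, ENNReal.ofReal ((2 ^ (-γ)) ^ k) *
          ∫⁻ x in Metric.ball (0 : R3) (2 ^ (k + 1)), ENNReal.ofReal (u x ^ 2) := by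
        rw [lintegral_tsum fun k => (hfm.const_mul _).indicator measurableSet_ball]
        refine tsum_congr fun k => ?_
        rw [lintegral_indicator measurableSet_ball, lintegral_const_mul' _ _ ENNReal.ofReal_ne_top]
        simp_rw [enorm_sq_eq_ofReal]
    _ ≤ ∑' k : ℕ, ENNReal.ofReal (A * q ^ k) * energySq a u ^ (1 / 2 : ℝ) := by
        refine ENNReal.tsum_le_tsum fun k => ?_
        calc _ ≤ ENNReal.ofReal ((2 ^ (-γ)) ^ k) *
              (ENNReal.ofReal ((a + 2 * 2 ^ (k + 1)) ^ (1 / 2 : ℝ)) *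
                energySq a u ^ (1 / 2 : ℝ)) := by
              gcongr
              exact setLIntegral_ball_le ha (by positivity)
          _ ≤ _ := by
              rw [← mul_assoc, ← ENNReal.ofReal_mul (by positivity)]
              exact mul_le_mul_left (ENNReal.ofReal_le_ofReal (hterm k)) _
    _ = _ := by
        rw [ENNReal.tsum_mul_right, ← ENNReal.ofReal_tsum_of_nonneg (fun k => by positivity) hsum]
        rfl

/-! ### Translation estimate for functions with a weak gradient -/

/-- Weighted Cauchy-Schwarz inequality. -/
theorem sq_lintegral_mul_le {α : Type*} [MeasurableSpace α] {μ : Measure α} {w f : α → ℝ≥0∞}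
    (hw : AEMeasurable w μ) (hf : AEMeasurable f μ) :
    (∫⁻ x, w x * f x ∂μ) ^ 2 ≤ (∫⁻ x, w x ∂μ) * ∫⁻ x, w x * f x ^ 2 ∂μ := by
  have h := ENNReal.lintegral_mul_le_Lp_mul_Lq μ Real.HolderConjugate.two_two
    (hw.pow_const (1 / 2 : ℝ)) ((hw.pow_const (1 / 2 : ℝ)).mul hf)
  have e1 : ∀ x : ℝ≥0∞, x ^ (1 / 2 : ℝ) * x ^ (1 / 2 : ℝ) = x := fun x => by
    rw [← ENNReal.rpow_add_of_nonneg _ _ (by norm_num) (by norm_num)]; norm_num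
  have e2 : ∀ x : ℝ≥0∞, (x ^ (1 / 2 : ℝ)) ^ (2 : ℝ) = x := fun x => by
    rw [← ENNReal.rpow_mul]; norm_num
  have e3 : ∀ x : ℝ≥0∞, (x ^ (1 / 2 : ℝ)) ^ 2 = x := fun x => by
    rw [sq, e1]
  simp only [Pi.mul_apply, ← mul_assoc, e1, e2, ENNReal.mul_rpow_of_nonneg _ _ zero_le_two] at h
  calc _ ≤ _ := pow_le_pow_left' h 2
    _ = _ := by rw [mul_pow, e3, e3]; simp

/-- Jensen's inequality for the square, on a space of measure one. -/
theorem enorm_integral_sq_le {α : Type*} [MeasurableSpace α] {μ : Measure α} [IsProbabilityMeasure μ]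
    {f : α → ℝ} (hf : AEStronglyMeasurable f μ) :
    ‖∫ x, f x ∂μ‖ₑ ^ 2 ≤ ∫⁻ x, ‖f x‖ₑ ^ 2 ∂μ := by
  refine (pow_le_pow_left' (enorm_integral_le_lintegral_enorm f) 2).trans ?_
  simpa using sq_lintegral_mul_le (μ := μ) (w := fun _ => 1) aemeasurable_const hf.enorm

/-- The derivative of a mollified function is the mollified weak gradient. -/
theorem HasWeakGradient.fderiv_convolution {u : R3 → ℝ} {g : R3 → R3} (hug : HasWeakGradient u g)
    {φ : R3 → ℝ} (hφ : ContDiff ℝ ∞ φ) (hc : HasCompactSupport φ) (x h : R3) :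
    fderiv ℝ (convolution φ u (ContinuousLinearMap.lsmul ℝ ℝ) volume) x h
      = ∫ y, inner ℝ (g y) h * φ (x - y) := by
  have hφ1 : ContDiff ℝ 1 φ := hφ.of_le (by exact_mod_cast le_top)
  have hψ : ContDiff ℝ ∞ (fun y => φ (x - y)) := hφ.comp (contDiff_const.sub contDiff_id)
  have hψc : HasCompactSupport (fun y => φ (x - y)) :=
    hc.comp_homeomorph (Homeomorph.subLeft x)
  -- The sign produced by the reflection y ↦ x - y cancels the one in the definition of the weak
  -- gradient.
  have hd : ∀ y k, fderiv ℝ (fun y => φ (x - y)) y k = - fderiv ℝ φ (x - y) k := by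
    intro y k
    have h1 : HasFDerivAt (fun y => φ (x - y)) _ y :=
      ((hφ1.differentiable one_ne_zero (x - y)).hasFDerivAt).comp y
        ((hasFDerivAt_id y).const_sub x)
    rw [h1.fderiv]; simp
  rw [(hc.hasFDerivAt_convolution_left (ContinuousLinearMap.lsmul ℝ ℝ) hφ1
    hug.locallyIntegrable x).fderiv, convolution_def]
  have hex := (hc.fderiv ℝ).convolutionExists_left
    ((ContinuousLinearMap.lsmul ℝ ℝ).precompL R3) (hφ1.continuous_fderiv one_ne_zero)
    hug.locallyIntegrable x
  rw [ContinuousLinearMap.integral_apply hex.integrable]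
  have hcoord : ∀ i, Integrable (fun y => g y i * φ (x - y)) := by
    intro i
    have := hug.locallyIntegrable_grad.integrable_smul_left_of_hasCompactSupport
      hψ.continuous hψc
    have h2 := (EuclideanSpace.proj (𝕜 := ℝ) i).integrable_comp this
    refine h2.congr (ae_of_all _ fun y => ?_)
    simp [mul_comm]
  have hint : ∀ i, Integrable (fun y => u y * fderiv ℝ (fun y => φ (x - y)) y
      (EuclideanSpace.single i 1)) := by
    intro i
    have := hug.locallyIntegrable.integrable_smul_left_of_hasCompactSupport
      (g := fun y => fderiv ℝ (fun y => φ (x - y)) y (EuclideanSpace.single i 1))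
      ((hψ.continuous_fderiv (by simp)).clm_apply continuous_const) (hψc.fderiv_apply ℝ _)
    refine this.congr (ae_of_all _ fun y => ?_)
    simp [mul_comm]
  have hh : h = ∑ i, h i • EuclideanSpace.single i (1 : ℝ) := by
    ext j; simp [Fin.sum_univ_three]; fin_cases j <;> simp
  calc _ = ∫ t, fderiv ℝ φ t h * u (x - t) := by
        simp [ContinuousLinearMap.precompL_apply]
    _ = ∫ y, fderiv ℝ φ (x - y) h * u y := by
        rw [← integral_sub_left_eq_self _ volume x]; simp
    _ = ∫ y, ∑ i, -(h i * (u y * fderiv ℝ (fun y => φ (x - y)) y (EuclideanSpace.single i 1))) := by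
        congr 1; ext y
        conv_lhs => rw [hh]
        simp only [map_sum, map_smul, hd, smul_eq_mul, Finset.sum_mul]
        refine Finset.sum_congr rfl fun i _ => by ring
    _ = ∑ i, h i * ∫ y, g y i * φ (x - y) := by
        rw [integral_finsetSum _ fun i _ => ((hint i).const_mul (h i)).fun_neg]
        refine Finset.sum_congr rfl fun i _ => ?_
        rw [integral_neg, integral_const_mul, hug.integral_eq _ hψ hψc]; ring
    _ = ∫ y, ∑ i, h i * (g y i * φ (x - y)) := by
        rw [integral_finsetSum _ fun i _ => (hcoord i).const_mul _]
        refine Finset.sum_congr rfl fun i _ => by rw [integral_const_mul]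
    _ = _ := by
        congr 1; ext y
        simp only [PiLp.inner_apply, Finset.sum_mul, RCLike.inner_apply, conj_trivial]
        refine Finset.sum_congr rfl fun i _ => by ring

/-- Young's inequality for the derivative of a mollified function. -/
theorem HasWeakGradient.lintegral_fderiv_convolution_le {u : R3 → ℝ} {g : R3 → R3}
    (hug : HasWeakGradient u g) {φ : R3 → ℝ} (hφ : ContDiff ℝ ∞ φ) (hc : HasCompactSupport φ)
    (h0 : ∀ x, 0 ≤ φ x) (h1 : ∫ x, φ x = 1) (h : R3) :
    ∫⁻ x, ‖fderiv ℝ (convolution φ u (ContinuousLinearMap.lsmul ℝ ℝ) volume) x h‖ₑ ^ 2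
      ≤ ‖h‖ₑ ^ 2 * ∫⁻ y, ‖g y‖ₑ ^ 2 := by
  have hgm : AEStronglyMeasurable g volume := hug.locallyIntegrable_grad.aestronglyMeasurable
  have hφm : Measurable φ := hφ.continuous.measurable
  have hmass : ∫⁻ x, ENNReal.ofReal (φ x) = 1 := by
    rw [← ofReal_integral_eq_lintegral_ofReal
      (hφ.continuous.integrable_of_hasCompactSupport hc) (ae_of_all _ h0), h1, ENNReal.ofReal_one]
  have hmassx : ∀ x, ∫⁻ y, ENNReal.ofReal (φ (x - y)) = 1 := fun x => by
    rw [lintegral_sub_left_eq_self (fun y => ENNReal.ofReal (φ y)) x, hmass]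
  have hpt : ∀ x, ‖fderiv ℝ (convolution φ u (ContinuousLinearMap.lsmul ℝ ℝ) volume) x h‖ₑ ^ 2
      ≤ ‖h‖ₑ ^ 2 * ∫⁻ y, ENNReal.ofReal (φ (x - y)) * ‖g y‖ₑ ^ 2 := by
    intro x
    rw [hug.fderiv_convolution hφ hc]
    have hb : ‖∫ y, inner ℝ (g y) h * φ (x - y)‖ₑ
        ≤ ‖h‖ₑ * ∫⁻ y, ENNReal.ofReal (φ (x - y)) * ‖g y‖ₑ := by
      refine (enorm_integral_le_lintegral_enorm _).trans ?_
      rw [← lintegral_const_mul' _ _ enorm_ne_top]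
      refine lintegral_mono fun y => ?_
      rw [enorm_mul, Real.enorm_eq_ofReal (h0 _)]
      have : ‖inner ℝ (g y) h‖ₑ ≤ ‖g y‖ₑ * ‖h‖ₑ := by
        simp only [enorm_eq_nnnorm]
        exact_mod_cast nnnorm_inner_le_nnnorm (𝕜 := ℝ) (g y) h
      calc _ ≤ ‖g y‖ₑ * ‖h‖ₑ * ENNReal.ofReal (φ (x - y)) := by gcongr
        _ = _ := by ring
    calc _ ≤ _ := pow_le_pow_left' hb 2
      _ ≤ _ := by
        rw [mul_pow]
        gcongr
        -- Cauchy-Schwarz with weight φ(x - y), whose total mass in y is one.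
        refine (sq_lintegral_mul_le (by fun_prop) hgm.enorm).trans ?_
        rw [hmassx, one_mul]
  calc _ ≤ ∫⁻ x, ‖h‖ₑ ^ 2 * ∫⁻ y, ENNReal.ofReal (φ (x - y)) * ‖g y‖ₑ ^ 2 := lintegral_mono hpt
    _ = ‖h‖ₑ ^ 2 * ∫⁻ x, ∫⁻ y, ENNReal.ofReal (φ (x - y)) * ‖g y‖ₑ ^ 2 :=
        lintegral_const_mul' _ _ (by simp)
    _ = ‖h‖ₑ ^ 2 * ∫⁻ y, ∫⁻ x, ENNReal.ofReal (φ (x - y)) * ‖g y‖ₑ ^ 2 := by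
        rw [lintegral_lintegral_swap]
        have : AEMeasurable (fun y => ‖g y‖ₑ ^ 2) volume := hgm.enorm.pow_const 2
        refine AEMeasurable.mul (Measurable.aemeasurable ?_) this.comp_snd
        fun_prop
    _ = _ := by
        congr 1
        refine lintegral_congr fun y => ?_
        rw [lintegral_mul_const' _ _ (by simp),
          lintegral_sub_right_eq_self (fun x => ENNReal.ofReal (φ x)) y, hmass, one_mul]

/-- `L²` estimate of the increments of a continuously differentiable function. -/
theorem lintegral_sub_translate_le_fderiv {w : R3 → ℝ} (hw : ContDiff ℝ 1 w) (h : R3) :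
    ∫⁻ x, ‖w (x + h) - w x‖ₑ ^ 2 ≤ ∫⁻ x, ‖fderiv ℝ w x h‖ₑ ^ 2 := by
  have hcont : Continuous fun p : R3 × ℝ => fderiv ℝ w (p.1 + p.2 • h) h :=
    ((hw.continuous_fderiv one_ne_zero).comp (by fun_prop)).clm_apply continuous_const
  -- The increment is the integral of the directional derivative along the unit segment, so Jensen
  -- applies with constant one.
  have : IsProbabilityMeasure (volume.restrict (Set.Ioc (0 : ℝ) 1)) := ⟨by simp⟩
  have hpt : ∀ x, ‖w (x + h) - w x‖ₑ ^ 2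
      ≤ ∫⁻ t in Set.Ioc (0 : ℝ) 1, ‖fderiv ℝ w (x + t • h) h‖ₑ ^ 2 := by
    intro x
    have hc : Continuous fun t : ℝ => fderiv ℝ w (x + t • h) h :=
      hcont.comp (Continuous.prodMk_right x)
    have hd : ∀ t : ℝ, HasDerivAt (fun t : ℝ => w (x + t • h)) (fderiv ℝ w (x + t • h) h) t := by
      intro t
      have hl : HasDerivAt (fun t : ℝ => x + t • h) h t := by
        simpa using ((hasDerivAt_id t).smul_const h).const_add x
      exact ((hw.differentiable one_ne_zero _).hasFDerivAt).comp_hasDerivAt t hl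
    have := intervalIntegral.integral_eq_sub_of_hasDerivAt (a := 0) (b := 1)
      (fun t _ => hd t) (hc.intervalIntegrable 0 1)
    simp only [one_smul, zero_smul, add_zero] at this
    rw [← this, intervalIntegral.integral_of_le zero_le_one]
    exact enorm_integral_sq_le hc.aestronglyMeasurable
  calc _ ≤ ∫⁻ x, ∫⁻ t in Set.Ioc (0 : ℝ) 1, ‖fderiv ℝ w (x + t • h) h‖ₑ ^ 2 := lintegral_mono hpt
    _ = ∫⁻ t in Set.Ioc (0 : ℝ) 1, ∫⁻ x, ‖fderiv ℝ w (x + t • h) h‖ₑ ^ 2 := by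
        rw [lintegral_lintegral_swap]
        exact (hcont.enorm.measurable.pow_const 2).aemeasurable
    _ = ∫⁻ t in Set.Ioc (0 : ℝ) 1, ∫⁻ x, ‖fderiv ℝ w x h‖ₑ ^ 2 := by
        refine lintegral_congr fun t => ?_
        rw [lintegral_add_right_eq_self (fun x => ‖fderiv ℝ w x h‖ₑ ^ 2)]
    _ = _ := by simp

/-- `L²` estimate of the increments of a function with a weak gradient. -/
theorem HasWeakGradient.lintegral_sub_translate_le {u : R3 → ℝ} {g : R3 → R3}
    (hug : HasWeakGradient u g) (h : R3) :
    ∫⁻ x, ‖u (x + h) - u x‖ₑ ^ 2 ≤ ‖h‖ₑ ^ 2 * ∫⁻ y, ‖g y‖ₑ ^ 2 := by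
  -- The outer radius is always twice the inner one: a bounded ratio is what the almost everywhere
  -- convergence of mollifications of a locally integrable function requires.
  let φ : ℕ → ContDiffBump (0 : R3) := fun n =>
    ⟨1 / ((n : ℝ) + 1), 2 * (1 / ((n : ℝ) + 1)), by positivity, by
      have : 0 < 1 / ((n : ℝ) + 1) := by positivity
      linarith⟩
  let w : ℕ → R3 → ℝ := fun n =>
    convolution ((φ n).normed volume) u (ContinuousLinearMap.lsmul ℝ ℝ) volume
  have hr : Tendsto (fun n => (φ n).rOut) atTop (𝓝 0) := by
    have := (tendsto_one_div_add_atTop_nhds_zero_nat (𝕜 := ℝ)).const_mul 2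
    rwa [mul_zero] at this
  have hae : ∀ᵐ x, Tendsto (fun n => w n x) atTop (𝓝 (u x)) :=
    ContDiffBump.ae_convolution_tendsto_right_of_locallyIntegrable hr
      (K := 2) (Eventually.of_forall fun n => le_rfl) hug.locallyIntegrable
  have haeh : ∀ᵐ x, Tendsto (fun n => w n (x + h)) atTop (𝓝 (u (x + h))) :=
    (measurePreserving_add_right volume h).quasiMeasurePreserving.ae hae
  have hwC : ∀ n, ContDiff ℝ 1 (w n) := fun n =>
    (φ n).hasCompactSupport_normed.contDiff_convolution_left _
      (φ n).contDiff_normed hug.locallyIntegrable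
  have hb : ∀ n, ∫⁻ x, ‖w n (x + h) - w n x‖ₑ ^ 2 ≤ ‖h‖ₑ ^ 2 * ∫⁻ y, ‖g y‖ₑ ^ 2 := fun n =>
    (lintegral_sub_translate_le_fderiv (hwC n) h).trans
      (hug.lintegral_fderiv_convolution_le (φ n).contDiff_normed (φ n).hasCompactSupport_normed
        (φ n).nonneg_normed (φ n).integral_normed h)
  -- Fatou's lemma transfers the bound, uniform in n, from the mollifications to `u`.
  calc _ = ∫⁻ x, liminf (fun n => ‖w n (x + h) - w n x‖ₑ ^ 2) atTop := by
        refine lintegral_congr_ae ?_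
        filter_upwards [hae, haeh] with x h1 h2
        exact (((ENNReal.continuous_pow 2).tendsto _).comp (h2.sub h1).enorm).liminf_eq.symm
    _ ≤ liminf (fun n => ∫⁻ x, ‖w n (x + h) - w n x‖ₑ ^ 2) atTop := by
        refine lintegral_liminf_le fun n => ?_
        have := (hwC n).continuous
        exact Continuous.measurable (by fun_prop)
    _ ≤ _ := liminf_le_of_frequently_le' (Frequently.of_forall hb)

/-! ### Weak compactness and a Cauchy criterion -/

/-- Bounded sequences in a separable Hilbert space have weakly convergent subsequences. -/
theorem exists_weakly_convergent_subseq {H : Type*} [NormedAddCommGroup H] [InnerProductSpace ℝ H]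
    [CompleteSpace H] [TopologicalSpace.SeparableSpace H] (U : ℕ → H) {M : ℝ}
    (hU : ∀ n, ‖U n‖ ≤ M) :
    ∃ (k : ℕ → ℕ) (V : H), StrictMono k ∧
      ∀ w, Tendsto (fun n => inner ℝ (U (k n)) w) atTop (𝓝 (inner ℝ V w)) := by
  -- Sequential Banach-Alaoglu, transported by the Riesz isometry.
  obtain ⟨L, -, k, hk, hL⟩ := WeakDual.isSeqCompact_closedBall ℝ H 0 M
    (x := fun n => StrongDual.toWeakDual (InnerProductSpace.toDual ℝ H (U n)))
    (fun n => by simpa using hU n)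
  refine ⟨k, (InnerProductSpace.toDual ℝ H).symm (WeakDual.toStrongDual L), hk, fun w => ?_⟩
  have h := ((WeakDual.eval_continuous w).tendsto L).comp hL
  simpa [Function.comp_def] using h

/-- A sequence in `L²` that is eventually close to single functions converges. -/
theorem exists_tendsto_eLpNorm_of_approx {α : Type*} [MeasurableSpace α] {μ : Measure α}
    {f : ℕ → α → ℝ} (hf : ∀ n, MemLp (f n) 2 μ)
    (h : ∀ δ : ℝ≥0∞, 0 < δ → ∃ A : α → ℝ, AEStronglyMeasurable A μ ∧
      ∀ᶠ n in atTop, eLpNorm (f n - A) 2 μ ≤ δ) :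
    ∃ v, MemLp v 2 μ ∧ Tendsto (fun n => eLpNorm (f n - v) 2 μ) atTop (𝓝 0) := by
  -- Terms close to a common A are close to each other, so A itself need not converge to anything as
  -- δ shrinks; completeness supplies the limit.
  have hc : CauchySeq fun n => (hf n).toLp (f n) := by
    refine EMetric.cauchySeq_iff.2 fun ε hε => ?_
    obtain ⟨ε', h0, h1⟩ := exists_between hε
    obtain ⟨A, hA, hev⟩ := h (ε' / 2) (ENNReal.half_pos h0.ne')
    obtain ⟨N, hN⟩ := eventually_atTop.1 hev
    refine ⟨N, fun m hm n hn => lt_of_le_of_lt ?_ h1⟩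
    rw [Lp.edist_toLp_toLp]
    calc eLpNorm (f m - f n) 2 μ = eLpNorm ((f m - A) - (f n - A)) 2 μ := by simp
      _ ≤ eLpNorm (f m - A) 2 μ + eLpNorm (f n - A) 2 μ :=
          eLpNorm_sub_le ((hf m).1.sub hA) ((hf n).1.sub hA) (by norm_num)
      _ ≤ ε' / 2 + ε' / 2 := add_le_add (hN m hm) (hN n hn)
      _ = ε' := ENNReal.add_halves ε'
  obtain ⟨V, hV⟩ := cauchySeq_tendsto_of_complete hc
  refine ⟨V, Lp.memLp V, ?_⟩
  rw [← Lp.toLp_coeFn V (Lp.memLp V)] at hV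
  exact (Lp.tendsto_Lp_iff_tendsto_eLpNorm'' f hf V (Lp.memLp V)).1 hV

/-! ### Averages over small balls -/

/-- The mean value of `u` over the ball of radius `ε` around `x`. -/
noncomputable def ballAverage (ε : ℝ) (u : R3 → ℝ) (x : R3) : ℝ :=
  ∫ z, u (x - z) ∂ProbabilityTheory.cond volume (Metric.ball (0 : R3) ε)

theorem isProbabilityMeasure_cond_ball {ε : ℝ} (hε : 0 < ε) :
    IsProbabilityMeasure (ProbabilityTheory.cond volume (Metric.ball (0 : R3) ε)) :=
  ProbabilityTheory.cond_isProbabilityMeasure_of_finite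
    (Metric.measure_ball_pos volume 0 hε).ne' measure_ball_lt_top.ne

theorem aestronglyMeasurable_sub_prod {u : R3 → ℝ} (hu : AEStronglyMeasurable u volume)
    (ν : Measure R3) [SFinite ν] :
    AEStronglyMeasurable (fun p : R3 × R3 => u (p.1 - p.2)) (volume.prod ν) :=
  hu.comp_quasiMeasurePreserving (quasiMeasurePreserving_sub_of_right_invariant volume ν)

theorem aestronglyMeasurable_ballAverage {ε : ℝ} (hε : 0 < ε) {u : R3 → ℝ}
    (hu : AEStronglyMeasurable u volume) : AEStronglyMeasurable (ballAverage ε u) volume :=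
  have := isProbabilityMeasure_cond_ball hε
  (aestronglyMeasurable_sub_prod hu _).integral_prod_right'

theorem integrable_sub_left_cond_ball {ε : ℝ} {u : R3 → ℝ}
    (hu : LocallyIntegrable u volume) (x : R3) :
    Integrable (fun z => u (x - z)) (ProbabilityTheory.cond volume (Metric.ball (0 : R3) ε)) := by
  -- For ε ≤ 0 the ball is empty and the conditional measure vanishes.
  by_cases h0 : volume (Metric.ball (0 : R3) ε) = 0
  · simp [ProbabilityTheory.cond, Measure.restrict_eq_zero.2 h0]
  refine Integrable.smul_measure ?_ (ENNReal.inv_ne_top.2 h0)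
  have h1 : IntegrableOn u (Metric.ball x ε) volume :=
    (hu.integrableOn_isCompact (isCompact_closedBall x ε)).mono_set Metric.ball_subset_closedBall
  have h2 := ((Measure.measurePreserving_sub_left volume x).integrableOn_comp_preimage
    (Homeomorph.subLeft x).measurableEmbedding).2 h1
  have h3 : (fun z => x - z) ⁻¹' Metric.ball x ε = Metric.ball 0 ε := by
    ext z; simp [dist_eq_norm]
  rw [← h3]
  exact h2

/-- Poincaré-type estimate for the averages over small balls. -/
theorem HasWeakGradient.lintegral_sub_ballAverage_le {u : R3 → ℝ} {g : R3 → R3}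
    (hug : HasWeakGradient u g) {ε : ℝ} (hε : 0 < ε) :
    ∫⁻ x, ‖u x - ballAverage ε u x‖ₑ ^ 2 ≤ ENNReal.ofReal ε ^ 2 * ∫⁻ y, ‖g y‖ₑ ^ 2 := by
  have := isProbabilityMeasure_cond_ball hε
  set ν := ProbabilityTheory.cond volume (Metric.ball (0 : R3) ε)
  have hu := hug.locallyIntegrable.aestronglyMeasurable
  have hmeas : AEStronglyMeasurable (fun p : R3 × R3 => u p.1 - u (p.1 - p.2))
      (volume.prod ν) := hu.comp_fst.sub (aestronglyMeasurable_sub_prod hu ν)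
  have hpt : ∀ x, ‖u x - ballAverage ε u x‖ₑ ^ 2 ≤ ∫⁻ z, ‖u x - u (x - z)‖ₑ ^ 2 ∂ν := by
    intro x
    have hi := integrable_sub_left_cond_ball (ε := ε) hug.locallyIntegrable x
    have : u x - ballAverage ε u x = ∫ z, (u x - u (x - z)) ∂ν := by
      rw [integral_sub (integrable_const _) hi]; simp [ballAverage, ν]
    rw [this]
    exact enorm_integral_sq_le (aestronglyMeasurable_const.sub hi.aestronglyMeasurable)
  calc _ ≤ ∫⁻ x, ∫⁻ z, ‖u x - u (x - z)‖ₑ ^ 2 ∂ν := lintegral_mono hpt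
    _ = ∫⁻ z, (∫⁻ x, ‖u x - u (x - z)‖ₑ ^ 2) ∂ν :=
        lintegral_lintegral_swap (hmeas.enorm.pow_const 2)
    _ ≤ ∫⁻ _, (ENNReal.ofReal ε ^ 2 * ∫⁻ y, ‖g y‖ₑ ^ 2) ∂ν := by
        refine lintegral_mono_ae ?_
        filter_upwards [ProbabilityTheory.ae_cond_mem measurableSet_ball] with z hz
        -- Every shift z that enters the average has |z| < ε, so each translate costs at most
        -- ε‖∇u‖₂.
        have h := hug.lintegral_sub_translate_le (-z)
        simp_rw [← sub_eq_add_neg, enorm_sub_rev (u (_ - z))] at h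
        refine h.trans ?_
        rw [mem_ball_zero_iff] at hz
        rw [enorm_neg, ← ofReal_norm]
        gcongr
    _ = _ := by simp

theorem measureZ_le_volume {γ : ℝ} (hγ : 0 ≤ γ) : measureZ γ ≤ volume := by
  calc measureZ γ ≤ volume.withDensity 1 := by
        refine withDensity_mono (ae_of_all _ fun x => ?_)
        refine ENNReal.ofReal_le_one.2 ?_
        rw [weightZ, div_le_one (by positivity)]
        exact Real.one_le_rpow (by linarith [norm_nonneg x]) hγ
    _ = _ := withDensity_one

/-- The function of `y` that represents `ballAverage ε · x` in `L²_Z`. -/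
noncomputable def averageKernel (γ ε : ℝ) (x y : R3) : ℝ :=
  (Metric.ball x ε).indicator
    (fun y => (volume (Metric.ball (0 : R3) ε)).toReal⁻¹ * (1 + ‖y‖) ^ γ) y

theorem measurable_averageKernel (γ ε : ℝ) (x : R3) : Measurable (averageKernel γ ε x) :=
  Measurable.indicator (by fun_prop) measurableSet_ball

/-- The factor (1 + |y|)^γ in the kernel cancels the density of `measureZ γ`. Taking the mean at a
fixed point thereby becomes a pairing that weak convergence in L²_Z can see. -/
theorem ballAverage_eq_integral_averageKernel (γ ε : ℝ) (u : R3 → ℝ) (x : R3) :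
    ballAverage ε u x = ∫ y, u y * averageKernel γ ε x y ∂measureZ γ := by
  have hmem : ∀ y, x - y ∈ Metric.ball (0 : R3) ε ↔ y ∈ Metric.ball x ε := fun y => by
    rw [mem_ball_zero_iff, Metric.mem_ball, dist_comm, dist_eq_norm]
  rw [measureZ, integral_withDensity_eq_integral_toReal_smul
    (measurable_weightZ γ).ennreal_ofReal (ae_of_all _ fun _ => ENNReal.ofReal_lt_top),
    ballAverage, ProbabilityTheory.cond, integral_smul_measure,
    ← integral_indicator measurableSet_ball, ← integral_sub_left_eq_self _ volume x,
    ← integral_smul]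
  congr 1; ext y
  rw [ENNReal.toReal_ofReal (weightZ_pos γ y).le]
  by_cases hy : y ∈ Metric.ball x ε
  · rw [Set.indicator_of_mem ((hmem y).2 hy), averageKernel, Set.indicator_of_mem hy, weightZ]
    have : (1 + ‖y‖) ^ γ ≠ 0 := by positivity
    simp only [sub_sub_cancel, ENNReal.toReal_inv, smul_eq_mul]
    field_simp
  · rw [Set.indicator_of_notMem (mt (hmem y).1 hy), averageKernel, Set.indicator_of_notMem hy]
    simp

/-- For |x| < R the kernels are supported in the ball of radius R + ε, where (1 + |y|)^γ is bounded.
The uniformity in x provides the dominating constant for `tendsto_lintegral_ballAverage`. -/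
theorem exists_eLpNorm_averageKernel_le {γ : ℝ} (hγ : 0 ≤ γ) (ε R : ℝ) :
    ∃ K : ℝ≥0, ∀ x ∈ Metric.ball (0 : R3) R, MemLp (averageKernel γ ε x) 2 (measureZ γ) ∧
      eLpNorm (averageKernel γ ε x) 2 (measureZ γ) ≤ K := by
  set c := (volume (Metric.ball (0 : R3) ε)).toReal⁻¹ * (1 + (R + ε)) ^ γ
  have hind : MemLp ((Metric.ball (0 : R3) (R + ε)).indicator fun _ => c) 2 (measureZ γ) :=
    memLp_indicator_const 2 measurableSet_ball c
      (Or.inr ((measureZ_le_volume hγ _).trans_lt measure_ball_lt_top).ne)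
  have hle : ∀ x ∈ Metric.ball (0 : R3) R, ∀ y, ‖averageKernel γ ε x y‖
      ≤ ‖(Metric.ball (0 : R3) (R + ε)).indicator (fun _ => c) y‖ := by
    intro x hx y
    by_cases hy : y ∈ Metric.ball x ε
    · have hy' : ‖y‖ < R + ε := by
        rw [mem_ball_zero_iff] at hx
        rw [Metric.mem_ball, dist_eq_norm] at hy
        linarith [norm_le_norm_add_norm_sub x y, norm_sub_rev x y]
      rw [averageKernel, Set.indicator_of_mem hy,
        Set.indicator_of_mem (by simpa using hy'), Real.norm_of_nonneg (by positivity),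
        Real.norm_eq_abs]
      refine le_trans ?_ (le_abs_self c)
      simp only [c]
      gcongr
    · rw [averageKernel, Set.indicator_of_notMem hy]
      simp
  refine ⟨(eLpNorm ((Metric.ball (0 : R3) (R + ε)).indicator fun _ => c) 2 (measureZ γ)).toNNReal,
    fun x hx => ⟨hind.mono (measurable_averageKernel γ ε x).aestronglyMeasurable
      (ae_of_all _ (hle x hx)), ?_⟩⟩
  rw [ENNReal.coe_toNNReal hind.2.ne]
  exact eLpNorm_mono (hle x hx)

/-- Averages of a weakly convergent sequence converge in `L²` of each ball. -/
theorem tendsto_lintegral_ballAverage {γ : ℝ} (hγ : 0 ≤ γ) {u : ℕ → R3 → ℝ}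
    (hu : ∀ n, MemLp (u n) 2 (measureZ γ)) (hum : ∀ n, AEStronglyMeasurable (u n) volume)
    {M : ℝ} (hM : ∀ n, ‖(hu n).toLp‖ ≤ M) {V : Lp ℝ 2 (measureZ γ)}
    (hV : ∀ w, Tendsto (fun n => inner ℝ ((hu n).toLp) w) atTop (𝓝 (inner ℝ V w)))
    {ε : ℝ} (hε : 0 < ε) (R : ℝ) :
    AEStronglyMeasurable (ballAverage ε V) (volume.restrict (Metric.ball (0 : R3) R)) ∧
    Tendsto (fun n => ∫⁻ x in Metric.ball (0 : R3) R,
      ‖ballAverage ε (u n) x - ballAverage ε V x‖ₑ ^ 2) atTop (𝓝 0) := by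
  set B := Metric.ball (0 : R3) R
  obtain ⟨K, hK⟩ := exists_eLpNorm_averageKernel_le hγ ε R
  have hM0 : 0 ≤ M := (norm_nonneg _).trans (hM 0)
  have hinner : ∀ f : R3 → ℝ, ∀ hf : MemLp f 2 (measureZ γ), ∀ x, ∀ hx : x ∈ B,
      ballAverage ε f x = inner ℝ (hf.toLp) ((hK x hx).1.toLp) := by
    intro f hf x hx
    rw [ballAverage_eq_integral_averageKernel γ, L2.inner_def]
    refine integral_congr_ae ?_
    filter_upwards [hf.coeFn_toLp, (hK x hx).1.coeFn_toLp] with y h1 h2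
    rw [h1, h2]
    simp [mul_comm]
  have hlim : ∀ x ∈ B, Tendsto (fun n => ballAverage ε (u n) x) atTop
      (𝓝 (ballAverage ε V x)) := by
    intro x hx
    rw [hinner V (Lp.memLp V) x hx, Lp.toLp_coeFn]
    simp_rw [hinner _ (hu _) x hx]
    exact hV _
  have hKn : ∀ x, ∀ hx : x ∈ B, ‖(hK x hx).1.toLp‖ ≤ K := by
    intro x hx
    rw [Lp.norm_toLp]
    exact ENNReal.toReal_le_coe_of_le_coe (hK x hx).2
  have hbd : ∀ n, ∀ x ∈ B, ‖ballAverage ε (u n) x‖ ≤ M * K := by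
    intro n x hx
    rw [hinner _ (hu n) x hx]
    exact (norm_inner_le_norm _ _).trans
      (mul_le_mul (hM n) (hKn x hx) (norm_nonneg _) hM0)
  have hbdV : ∀ x ∈ B, ‖ballAverage ε V x‖ ≤ M * K := fun x hx =>
    le_of_tendsto (hlim x hx).norm (Eventually.of_forall fun n => hbd n x hx)
  have hmn : ∀ n, AEStronglyMeasurable (ballAverage ε (u n)) (volume.restrict B) := fun n =>
    (aestronglyMeasurable_ballAverage hε (hum n)).restrict
  have haeB : ∀ᵐ x ∂(volume.restrict B), x ∈ B := ae_restrict_mem measurableSet_ball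
  have hmV : AEStronglyMeasurable (ballAverage ε V) (volume.restrict B) :=
    aestronglyMeasurable_of_tendsto_ae atTop hmn (haeB.mono hlim)
  refine ⟨hmV, ?_⟩
  -- By Cauchy-Schwarz both averages are at most MK on the ball, which has finite volume.
  have h := tendsto_lintegral_of_dominated_convergence' (μ := volume.restrict B)
    (F := fun n x => ‖ballAverage ε (u n) x - ballAverage ε V x‖ₑ ^ 2) (f := fun _ => 0)
    (fun _ => ENNReal.ofReal (M * K + M * K) ^ 2)
    (fun n => ((hmn n).sub hmV).enorm.pow_const 2)
    (fun n => haeB.mono fun x hx => by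
      simp only
      gcongr
      rw [← ofReal_norm]
      exact ENNReal.ofReal_le_ofReal
        ((norm_sub_le _ _).trans (add_le_add (hbd n x hx) (hbdV x hx))))
    (by
      rw [lintegral_const, Measure.restrict_apply_univ]
      exact ENNReal.mul_ne_top (by simp) measure_ball_lt_top.ne)
    (haeB.mono fun x hx => by
      have h1 := ((hlim x hx).sub_const (ballAverage ε V x)).enorm
      have h2 := ((ENNReal.continuous_pow 2).tendsto _).comp h1
      simpa [Function.comp_def] using h2)
  simpa using h

/-! ### Tails and the two embeddings -/

/-- The weighted mass outside a ball is small. -/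
theorem setLIntegral_compl_ball_le {γ β : ℝ} (hβ : β ≤ γ) {R : ℝ} (hR : 0 ≤ R) (u : R3 → ℝ) :
    ∫⁻ x in (Metric.ball (0 : R3) R)ᶜ, ‖u x‖ₑ ^ 2 ∂measureZ γ
      ≤ ENNReal.ofReal ((1 + R) ^ (-(γ - β))) * normL2Z β u ^ 2 := by
  rw [normL2Z_sq, lintegral_measureZ, ← lintegral_indicator measurableSet_ball.compl,
    lintegral_measureZ, ← lintegral_const_mul' _ _ ENNReal.ofReal_ne_top]
  refine lintegral_mono fun x => ?_
  by_cases hx : x ∈ Metric.ball (0 : R3) R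
  · simp [hx]
  · rw [Set.indicator_of_mem hx, ← mul_assoc, ← ENNReal.ofReal_mul (by positivity)]
    gcongr
    rw [mem_ball_zero_iff, not_lt] at hx
    rw [weightZ, weightZ, one_div, one_div, ← Real.rpow_neg (by positivity),
      ← Real.rpow_neg (by positivity)]
    -- Outside the ball the surplus decay (1 + |x|)^{-(γ-β)} is at most (1 + R)^{-(γ-β)}.
    calc (1 + ‖x‖) ^ (-γ) = (1 + ‖x‖) ^ (-(γ - β)) * (1 + ‖x‖) ^ (-β) := by
          rw [← Real.rpow_add (by positivity)]; congr 1; ring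
      _ ≤ _ := by
          gcongr ?_ * _
          exact Real.rpow_le_rpow_of_nonpos (by positivity) (by linarith) (by linarith)

theorem rpow_half_sq (x : ℝ≥0∞) : (x ^ (1 / 2 : ℝ)) ^ 2 = x := by
  rw [← ENNReal.rpow_natCast, ← ENNReal.rpow_mul]
  norm_num

theorem normE_sq (a : ℝ) (u : R3 → ℝ) :
    normE a u ^ 2 = normD12 u ^ 2 + energySq a u ^ (1 / 2 : ℝ) := rpow_half_sq _

theorem normHZ_sq (γ : ℝ) (u : R3 → ℝ) :
    normHZ γ u ^ 2 = normD12 u ^ 2 + normL2Z γ u ^ 2 := rpow_half_sq _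

theorem normL2Z_le_normHZ (γ : ℝ) (u : R3 → ℝ) : normL2Z γ u ≤ normHZ γ u :=
  (ENNReal.pow_le_pow_left_iff two_ne_zero).1 (by rw [normHZ_sq]; exact le_add_self)

/-- `ℰ` is continuously embedded into `H_Z`. -/
theorem continuouslyEmbedded_normHZ {a : ℝ} (ha : 0 < a) {γ : ℝ} (hγ : 1 / 2 < γ) :
    ContinuouslyEmbedded (MemE a) (normE a) (MemHZ γ) (normHZ γ) := by
  obtain ⟨C, hC⟩ := exists_normL2Z_sq_le ha hγ
  refine ⟨fun u hu => ⟨hu.1, ?_⟩, 1 + C, fun u hu => (ENNReal.pow_le_pow_left_iff two_ne_zero).1 ?_⟩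
  · refine ⟨hu.1.1.1.mono_ac (withDensity_absolutelyContinuous _ _), ?_⟩
    have h := (hC u hu.1.1.1).trans_lt
      (ENNReal.mul_lt_top ENNReal.coe_lt_top (ENNReal.rpow_lt_top_of_nonneg (by norm_num) hu.2.ne))
    exact (ENNReal.pow_lt_top_iff.1 h).resolve_right two_ne_zero
  · have hCC : (1 : ℝ≥0∞) + C ≤ (1 + C) ^ 2 := le_self_pow (by simp) two_ne_zero
    rw [normHZ_sq, mul_pow, normE_sq, ENNReal.coe_add, ENNReal.coe_one]
    calc normD12 u ^ 2 + normL2Z γ u ^ 2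
        ≤ 1 * normD12 u ^ 2 + C * energySq a u ^ (1 / 2 : ℝ) := by
          rw [one_mul]; gcongr; exact hC u hu.1.1.1
      _ ≤ (1 + C) * normD12 u ^ 2 + (1 + C) * energySq a u ^ (1 / 2 : ℝ) := by
          gcongr
          · exact le_self_add
          · exact le_add_self
      _ = (1 + C) * (normD12 u ^ 2 + energySq a u ^ (1 / 2 : ℝ)) := by ring
      _ ≤ _ := by gcongr

/-- `ℰ` is continuously embedded into `L²_Z`. -/
theorem continuouslyEmbedded_normL2Z {a : ℝ} (ha : 0 < a) {γ : ℝ} (hγ : 1 / 2 < γ) :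
    ContinuouslyEmbedded (MemE a) (normE a) (MemL2Z γ) (normL2Z γ) := by
  obtain ⟨hmem, C, hC⟩ := continuouslyEmbedded_normHZ ha hγ
  exact ⟨fun u hu => (hmem u hu).2, C, fun u hu => (normL2Z_le_normHZ γ u).trans (hC u hu)⟩

/-- The embedding of `ℰ` into `L²_Z` is compact. -/
theorem compactlyEmbedded_normL2Z {a : ℝ} (ha : 0 < a) {γ : ℝ} (hγ : 1 / 2 < γ) :
    CompactlyEmbedded (MemE a) (normE a) (MemL2Z γ) (normL2Z γ) := by
  refine ⟨continuouslyEmbedded_normL2Z ha hγ, ?_⟩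
  rintro u hu ⟨M, hM⟩
  have hγ0 : 0 ≤ γ := by linarith
  -- The embedding for β, still above 1/2, yields tails that vanish uniformly along the sequence.
  obtain ⟨β, hβ, hβγ⟩ := exists_between hγ
  obtain ⟨hmem, C, hC⟩ := continuouslyEmbedded_normL2Z ha hγ
  obtain ⟨-, C', hC'⟩ := continuouslyEmbedded_normL2Z ha hβ
  have huL : ∀ n, MemLp (u n) 2 (measureZ γ) := fun n => hmem _ (hu n)
  have hum : ∀ n, AEStronglyMeasurable (u n) volume := fun n => (hu n).1.1.1
  have hb : ∀ n, normL2Z γ (u n) ≤ C * M := fun n =>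
    (hC _ (hu n)).trans (mul_le_mul_right (hM n) _)
  have hb' : ∀ n, normL2Z β (u n) ≤ C' * M := fun n =>
    (hC' _ (hu n)).trans (mul_le_mul_right (hM n) _)
  have hgrad : ∀ n, ∫⁻ y, ‖weakGradient (u n) y‖ₑ ^ 2 ≤ (M : ℝ≥0∞) ^ 2 := by
    intro n
    have h : normD12 (u n) ^ 2 ≤ (M : ℝ≥0∞) ^ 2 :=
      (le_self_add.trans_eq (normE_sq a (u n)).symm).trans (pow_le_pow_left' (hM n) 2)
    refine le_trans (le_of_eq ?_) h
    simpa [normD12] using (eLpNorm_two_sq (μ := volume) fun y => ‖weakGradient (u n) y‖).symm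
  have hnorm : ∀ n, ‖(huL n).toLp‖ ≤ C * M := fun n => by
    rw [Lp.norm_toLp]
    exact ENNReal.toReal_le_coe_of_le_coe (b := C * M) (by exact_mod_cast hb n)
  -- Local finiteness, together with the finite exponent 2, makes L²_Z separable, as extraction of a
  -- weak limit requires.
  have : IsFiniteMeasureOnCompacts (measureZ γ) :=
    ⟨fun K hK => (measureZ_le_volume hγ0 K).trans_lt hK.measure_lt_top⟩
  have : Fact ((2 : ℝ≥0∞) ≠ ⊤) := ⟨by norm_num⟩
  obtain ⟨k, V, hk, hV⟩ := exists_weakly_convergent_subseq (fun n => (huL n).toLp) hnorm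
  -- The subsequence is fixed before δ, so no diagonal argument is needed. Then ε comes from the
  -- gradient bound, R from the tail bound, and n is taken large last.
  have happrox : ∀ δ : ℝ≥0∞, 0 < δ → ∃ A : R3 → ℝ, AEStronglyMeasurable A (measureZ γ) ∧
      ∀ᶠ n in atTop, eLpNorm (u (k n) - A) 2 (measureZ γ) ≤ δ := by
    intro δ hδ
    have hδ3 : 0 < δ / 3 := ENNReal.div_pos hδ.ne' (by norm_num)
    have hδ3' : 0 < (δ / 3) ^ 2 := ENNReal.pow_pos hδ3 2
    obtain ⟨ε, hεδ, hε⟩ : ∃ ε : ℝ, ENNReal.ofReal ε ^ 2 * (M : ℝ≥0∞) ^ 2 ≤ (δ / 3) ^ 2 ∧ 0 < ε := by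
      have h : Tendsto (fun ε : ℝ => ENNReal.ofReal ε ^ 2 * (M : ℝ≥0∞) ^ 2) (𝓝[>] 0) (𝓝 0) := by
        have h1 := (ENNReal.continuous_pow 2).comp ENNReal.continuous_ofReal
        have h2 := (ENNReal.continuous_mul_const (a := (M : ℝ≥0∞) ^ 2) (by simp)).comp h1
        have h3 := (h2.tendsto 0).mono_left (nhdsWithin_le_nhds (s := Set.Ioi 0))
        simpa [Function.comp_def] using h3
      exact ((h.eventually (ge_mem_nhds hδ3')).and self_mem_nhdsWithin).exists
    obtain ⟨R, hRδ, hR⟩ : ∃ R : ℝ, ENNReal.ofReal ((1 + R) ^ (-(γ - β))) * (C' * M : ℝ≥0∞) ^ 2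
        ≤ (δ / 3) ^ 2 ∧ 0 ≤ R := by
      have h : Tendsto (fun R : ℝ => ENNReal.ofReal ((1 + R) ^ (-(γ - β))) * (C' * M : ℝ≥0∞) ^ 2)
          atTop (𝓝 0) := by
        have h1 := (tendsto_rpow_neg_atTop (y := γ - β) (by linarith)).comp
          (tendsto_atTop_add_const_left atTop (1 : ℝ) tendsto_id)
        have h2 := ENNReal.tendsto_ofReal h1
        have h3 := ENNReal.Tendsto.mul_const (b := (C' * M : ℝ≥0∞) ^ 2) h2
          (Or.inr (ENNReal.pow_ne_top (ENNReal.mul_ne_top (by simp) (by simp))))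
        simpa [Function.comp_def] using h3
      exact ((h.eventually (ge_mem_nhds hδ3')).and (eventually_ge_atTop 0)).exists
    obtain ⟨hAm, hA⟩ := tendsto_lintegral_ballAverage hγ0 (fun n => huL (k n))
      (fun n => hum (k n)) (fun n => hnorm (k n)) hV hε R
    set B := Metric.ball (0 : R3) R
    have hB : MeasurableSet B := measurableSet_ball
    have hac : measureZ γ ≪ volume := withDensity_absolutelyContinuous _ _
    refine ⟨B.indicator (ballAverage ε V),
      ((aestronglyMeasurable_indicator_iff hB).2 hAm).mono_ac hac, ?_⟩
    filter_upwards [hA.eventually (ge_mem_nhds hδ3')] with n hn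
    have hm1 : AEStronglyMeasurable (B.indicator (u (k n) - ballAverage ε (u (k n))))
        (measureZ γ) :=
      (((hum _).sub (aestronglyMeasurable_ballAverage hε (hum _))).indicator hB).mono_ac hac
    have hm2 : AEStronglyMeasurable (B.indicator (ballAverage ε (u (k n)) - ballAverage ε V))
        (measureZ γ) :=
      ((aestronglyMeasurable_indicator_iff hB).2
        ((aestronglyMeasurable_ballAverage hε (hum _)).restrict.sub hAm)).mono_ac hac
    have hm3 : AEStronglyMeasurable (Bᶜ.indicator (u (k n))) (measureZ γ) :=
      ((hum _).indicator hB.compl).mono_ac hac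
    have hsplit : u (k n) - B.indicator (ballAverage ε V) =
        B.indicator (u (k n) - ballAverage ε (u (k n))) +
          B.indicator (ballAverage ε (u (k n)) - ballAverage ε V) + Bᶜ.indicator (u (k n)) := by
      ext x
      by_cases hx : x ∈ B <;> simp [hx]
    -- Since Z ≤ 1, estimates in unweighted L² of the ball suffice.
    have hsq : ∀ f : R3 → ℝ, eLpNorm (B.indicator f) 2 (measureZ γ) ^ 2
        ≤ ∫⁻ x in B, ‖f x‖ₑ ^ 2 := fun f => by
      rw [eLpNorm_indicator_eq_eLpNorm_restrict hB, eLpNorm_two_sq]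
      exact lintegral_mono' (Measure.restrict_mono le_rfl (measureZ_le_volume hγ0)) le_rfl
    have h1 : eLpNorm (B.indicator (u (k n) - ballAverage ε (u (k n)))) 2 (measureZ γ) ≤ δ / 3 := by
      refine (ENNReal.pow_le_pow_left_iff two_ne_zero).1 ((hsq _).trans ((setLIntegral_le_lintegral _ _).trans ?_))
      refine ((hasWeakGradient_weakGradient (hu (k n)).1.2.1).lintegral_sub_ballAverage_le
        hε).trans (le_trans ?_ hεδ)
      gcongr
      exact hgrad _
    have h2 : eLpNorm (B.indicator (ballAverage ε (u (k n)) - ballAverage ε V)) 2 (measureZ γ)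
        ≤ δ / 3 := (ENNReal.pow_le_pow_left_iff two_ne_zero).1 ((hsq _).trans hn)
    have h3 : eLpNorm (Bᶜ.indicator (u (k n))) 2 (measureZ γ) ≤ δ / 3 := by
      refine (ENNReal.pow_le_pow_left_iff two_ne_zero).1 ?_
      rw [eLpNorm_indicator_eq_eLpNorm_restrict hB.compl, eLpNorm_two_sq]
      refine (setLIntegral_compl_ball_le hβγ.le hR _).trans (le_trans ?_ hRδ)
      gcongr
      exact hb' _
    rw [hsplit]
    calc _ ≤ _ := eLpNorm_add_le (hm1.add hm2) hm3 (by norm_num)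
      _ ≤ (δ / 3 + δ / 3) + δ / 3 :=
          add_le_add ((eLpNorm_add_le hm1 hm2 (by norm_num)).trans (add_le_add h1 h2)) h3
      _ = δ := ENNReal.add_thirds δ
  obtain ⟨v, hv, hlim⟩ := exists_tendsto_eLpNorm_of_approx (fun n => huL (k n)) happrox
  exact ⟨v, k, hv, hk, hlim⟩

end BoppPodolsky

theorem mainTheorem9 (a : ℝ) (ha : 0 < a) (γ : ℝ) (hγ : 1 / 2 < γ) :
    BoppPodolsky.ContinuouslyEmbedded
        (BoppPodolsky.MemE a) (BoppPodolsky.normE a)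
        (BoppPodolsky.MemHZ γ) (BoppPodolsky.normHZ γ) ∧
      BoppPodolsky.CompactlyEmbedded
        (BoppPodolsky.MemE a) (BoppPodolsky.normE a)
        (BoppPodolsky.MemL2Z γ) (BoppPodolsky.normL2Z γ) :=
  ⟨BoppPodolsky.continuouslyEmbedded_normHZ ha hγ, BoppPodolsky.compactlyEmbedded_normL2Z ha hγ⟩
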